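/- Let $\mathcal H$ be a complex Hilbert space (of arbitrary, possibly infinite, dimension), let $|\psi\rangle\in\mathcal H$ be a unit vector, and let $A_i$, $B_i$ $(i\in\{1,2,3\})$ and $M_{ij}=M_{ji}$ $(i\neq j\in\{1,2,3\})$ be $\pm1$-valued projective observables on $\mathcal H$, i.e. bounded self-adjoint operators with $A_i^2=B_i^2=M_{ij}^2=\mathbb 1$. No commutation relations between them are assumed. For observables $C_1,\dots,C_n$ measured projectively in the order $C_1\to C_2\to\dots\to C_n$ on $|\psi\rangle$ let $$\langle C_1\cdots C_n\rangle_{seq}=\sum_{c_1,\dots,c_n=\pm1}c_1\cdots c_n\,\Big\|\tfrac{\mathbb 1+c_nC_n}{2}\cdots\tfrac{\mathbb 1+c_1C_1}{2}|\psi\rangle\Big\|^2$$ be the expected product of the outcomes; it equals $2^{-(n-1)}\langle\psi|\{C_1,\{C_2,\dots,\{C_{n-1},C_n\}\}\}|\psi\rangle$. Let $\langle C_1\cdots C_n\rangle_\pi$ be the average of $\langle C_{\sigma(1)}\cdots C_{\sigma(n)}\rangle_{seq}$ over a set $S$ of permutations $\sigma$ such that each of the $n!$ products $C_{\tau(1)}\cdots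 C_{\tau(n)}$ occurs in the expansion of at least one of the corresponding nested anticommutators (for example, $\langle C_1C_2\rangle_\pi=\langle C_1C_2\rangle_{seq}$ and $\langle C_1C_2C_3\rangle_\pi=\frac12(\langle C_1C_2C_3\rangle_{seq}+\langle C_2C_1C_3\rangle_{seq})$). The set $S$ is arbitrary with this property and may be chosen separately for each correlator. Put $$\begin{aligned}T_3={}&\langle A_1A_2B_3M_{12}\rangle_\pi+\langle A_3A_1B_2M_{31}\rangle_\pi+\langle A_2A_3B_1M_{23}\rangle_\pi+\langle A_1B_2B_3\rangle_\pi+\langle B_1A_2B_3\rangle_\pi+\langle B_1B_2A_3\rangle_\pi\\&-\langle A_1A_2A_3\rangle_\pi+\langle M_{23}M_{31}\rangle_\pi+\langle M_{31}M_{12}\rangle_\pi+\langle M_{23}M_{12}\rangle_\pi .\end{aligned}$$ Suppose that $T_3$ takes its maximal value $10$. Then the subspace $$V_3=\mathrm{span}\{|\psi\rangle,A_1|\psi\rangle,A_2|\psi\rangle,A_3|\psi\rangle,B_1|\psi\rangle,B_2|\psi\rangle,B_3|\psi\rangle,A_1B_1|\psi\rangle\}$$ has dimension $8$ and is invariant under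 all $A_i$, $B_i$ and $M_{ij}$. Moreover, with $P:\mathcal H\to V_3$ the orthogonal projection onto $V_3$ (so that $P^\dagger$ is the inclusion $V_3\hookrightarrow\mathcal H$), there is a unitary $U:V_3\to(\mathbb C^2)^{\otimes3}$ such that, for all $i$ and for all $i\neq j$ with $k$ the third index, $$U(PA_iP^\dagger)U^\dagger=X_i,\qquad U(PB_iP^\dagger)U^\dagger=Z_i,\qquad U(PM_{ij}P^\dagger)U^\dagger=X_iX_jZ_k,\qquad U(P|\psi\rangle)=|G_3\rangle,$$ where $X_i,Z_i$ are the Pauli operators on the $i$-th qubit and $$|G_3\rangle=\tfrac1{\sqrt8}\big(|000\rangle+|100\rangle+|010\rangle-|110\rangle+|001\rangle-|101\rangle-|011\rangle-|111\rangle\big)$$ is the three-qubit complete-graph state. -/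

import Mathlib

namespace TemporalSelfTest

noncomputable section

section Sequential

variable {H : Type*} [NormedAddCommGroup H] [InnerProductSpace ℂ H]

/-- A projective measurement with outcomes `±1`, encoded by its observable: a self-adjoint bounded
operator that squares to the identity. -/
def IsDichotomic [CompleteSpace H] (M : H →L[ℂ] H) : Prop :=
  IsSelfAdjoint M ∧ M * M = 1

/-- The projector `(1 + m M) / 2` onto the eigenspace of `M` for the outcome `m = ±1`. -/
def outcomeProj (M : H →L[ℂ] H) (m : ℤˣ) : H →L[ℂ] H :=
  (1 / 2 : ℂ) • (1 + (m : ℤ) • M)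

/-- The unnormalized state left after measuring `M 0 → M 1 → ⋯ → M (n-1)`, in this order, on `ψ`
with outcomes `m 0, …, m (n-1)`. -/
def postState {n : ℕ} (M : Fin n → (H →L[ℂ] H)) (m : Fin n → ℤˣ) (ψ : H) : H :=
  (List.ofFn fun i => outcomeProj (M i) (m i)).foldl (fun φ Q => Q φ) ψ

/-- Born's rule: the joint probability of the outcomes `m` of the sequence `M 0 → ⋯ → M (n-1)`. -/
def outcomeProb {n : ℕ} (M : Fin n → (H →L[ℂ] H)) (m : Fin n → ℤˣ) (ψ : H) : ℝ :=
  ‖postState M m ψ‖ ^ 2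

/-- The sequential correlation `⟨M 0 ⋯ M (n-1)⟩_seq`: the expectation of the product of the outcomes
of the measurements performed in the order `M 0 → ⋯ → M (n-1)`. -/
def seqCorr {n : ℕ} (M : Fin n → (H →L[ℂ] H)) (ψ : H) : ℝ :=
  ∑ m : Fin n → ℤˣ, (∏ i, ((m i : ℤ) : ℝ)) * outcomeProb M m ψ

/-- The monomials that occur in the nested anticommutator `{a₁, {a₂, …, {aₙ₋₁, aₙ}}}`, that is, the
products whose expectation values occur in the sequential correlation for `a₁ → ⋯ → aₙ`. -/
def seqWords {α : Type*} : List α → List (List α)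
  | [] => [[]]
  | a :: l => (seqWords l).map (fun w => a :: w) ++ (seqWords l).map (fun w => w ++ [a])

/-- A set of measurement orders is complete if each of the `n!` permutations of the product of the
`n` observables occurs in at least one of the corresponding sequential correlations. -/
def CoversAllOrders {n : ℕ} (S : Finset (Equiv.Perm (Fin n))) : Prop :=
  ∀ τ : Equiv.Perm (Fin n), ∃ σ ∈ S, List.ofFn τ ∈ seqWords (List.ofFn σ)

/-- A complete set of orders in which `n` measurements are performed. -/
abbrev OrderSet (n : ℕ) : Type := {S : Finset (Equiv.Perm (Fin n)) // CoversAllOrders S}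

/-- For two measurements the single order `M₁ → M₂` is complete. -/
theorem coversAllOrders_two : CoversAllOrders ({1} : Finset (Equiv.Perm (Fin 2))) := by
  unfold CoversAllOrders; decide

/-- For three measurements the orders `M₁ → M₂ → M₃` and `M₂ → M₁ → M₃` are complete. -/
theorem coversAllOrders_three :
    CoversAllOrders ({1, Equiv.swap 0 1} : Finset (Equiv.Perm (Fin 3))) := by
  unfold CoversAllOrders; decide

/-- `⟨M 0 ⋯ M (n-1)⟩_π`: the average of the sequential correlations over the orders in `S`. -/
def permCorr {n : ℕ} (S : OrderSet n) (M : Fin n → (H →L[ℂ] H)) (ψ : H) : ℝ :=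
  (S.1.card : ℝ)⁻¹ * ∑ σ ∈ S.1, seqCorr (fun i => M (σ i)) ψ

/-- The temporal expression `T₃`; the indices `1, 2, 3` are written `0, 1, 2`. The arguments
`π₄, π₃, π₂` are the sets of orders used for each correlator of four, three and two observables. -/
def T₃ (π₄ : Fin 3 → OrderSet 4) (π₃ : Fin 4 → OrderSet 3) (π₂ : Fin 3 → OrderSet 2)
    (A B : Fin 3 → (H →L[ℂ] H)) (M : Fin 3 → Fin 3 → (H →L[ℂ] H)) (ψ : H) : ℝ :=
  permCorr (π₄ 0) ![A 0, A 1, B 2, M 0 1] ψ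
    + permCorr (π₄ 1) ![A 2, A 0, B 1, M 2 0] ψ
    + permCorr (π₄ 2) ![A 1, A 2, B 0, M 1 2] ψ
    + permCorr (π₃ 0) ![A 0, B 1, B 2] ψ
    + permCorr (π₃ 1) ![B 0, A 1, B 2] ψ
    + permCorr (π₃ 2) ![B 0, B 1, A 2] ψ
    - permCorr (π₃ 3) ![A 0, A 1, A 2] ψ
    + permCorr (π₂ 0) ![M 1 2, M 2 0] ψ
    + permCorr (π₂ 1) ![M 2 0, M 0 1] ψ
    + permCorr (π₂ 2) ![M 1 2, M 0 1] ψ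

/-- The subspace spanned by `ψ`, the `A i ψ`, the `B i ψ` and `A 0 (B 0 ψ)`. -/
def V₃ (A B : Fin 3 → (H →L[ℂ] H)) (ψ : H) : Submodule ℂ H :=
  Submodule.span ℂ (Set.range
    ![ψ, A 0 ψ, A 1 ψ, A 2 ψ, B 0 ψ, B 1 ψ, B 2 ψ, A 0 (B 0 ψ)])

instance finiteDimensional_V₃ (A B : Fin 3 → (H →L[ℂ] H)) (ψ : H) : FiniteDimensional ℂ (V₃ A B ψ) :=
  FiniteDimensional.span_of_finite ℂ (Set.finite_range _)

/-- `P M P†`, where `P : H → V` is the orthogonal projection onto `V`; its adjoint `P†` is the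
inclusion of `V` into `H`. -/
def compress (V : Submodule ℂ H) [V.HasOrthogonalProjection] (M : H →L[ℂ] H) : V →L[ℂ] V :=
  V.orthogonalProjectionOnto ∘L M ∘L V.subtypeL

end Sequential

/-- The Hilbert space `ℂ²` of a qubit. -/
abbrev Qubit : Type := EuclideanSpace ℂ (Fin 2)

/-- The Hilbert space `(ℂ²)^{⊗3}` of three qubits in the computational basis: the basis vectors
`|x 0, x 1, x 2⟩` are indexed by the maps `x : Fin 3 → Fin 2`. -/
abbrev ThreeQubits : Type := EuclideanSpace ℂ (Fin 3 → Fin 2)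

/-- The product vector `v 0 ⊗ v 1 ⊗ v 2`. -/
def productVec (v : Fin 3 → Qubit) : ThreeQubits :=
  WithLp.toLp 2 fun x => ∏ l, v l (x l)

/-- The Pauli matrix `X`. -/
def pauliX : Matrix (Fin 2) (Fin 2) ℂ := !![0, 1; 1, 0]

/-- The Pauli matrix `Z`. -/
def pauliZ : Matrix (Fin 2) (Fin 2) ℂ := !![1, 0; 0, -1]

/-- The operator `σ 0 ⊗ σ 1 ⊗ σ 2` on three qubits (Kronecker product of matrices). -/
def tensorOp (σ : Fin 3 → Matrix (Fin 2) (Fin 2) ℂ) : ThreeQubits →L[ℂ] ThreeQubits :=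
  Matrix.toEuclideanCLM (𝕜 := ℂ) (Matrix.of fun x y => ∏ l, σ l (x l) (y l))

/-- The operator `σ 0 ⊗ σ 1 ⊗ σ 2` acts factor by factor on product vectors. -/
theorem tensorOp_productVec (σ : Fin 3 → Matrix (Fin 2) (Fin 2) ℂ) (v : Fin 3 → Qubit) :
    tensorOp σ (productVec v)
      = productVec fun l => Matrix.toEuclideanCLM (𝕜 := ℂ) (σ l) (v l) := by
  ext x
  simp only [tensorOp, productVec, Matrix.ofLp_toEuclideanCLM, Matrix.mulVec, dotProduct,
    Matrix.of_apply, ← Finset.prod_mul_distrib, Finset.prod_univ_sum, Fintype.piFinset_univ]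

/-- The inner product of product vectors is the product of the inner products. -/
theorem inner_productVec (v w : Fin 3 → Qubit) :
    inner ℂ (productVec v) (productVec w) = ∏ l, inner ℂ (v l) (w l) := by
  simp only [productVec, PiLp.inner_apply, RCLike.inner_apply, map_prod,
    ← Finset.prod_mul_distrib, Finset.prod_univ_sum, Fintype.piFinset_univ]

/-- `X` on the `i`-th qubit. -/
def X (i : Fin 3) : ThreeQubits →L[ℂ] ThreeQubits :=
  tensorOp fun l => if l = i then pauliX else 1

/-- `Z` on the `i`-th qubit. -/
def Z (i : Fin 3) : ThreeQubits →L[ℂ] ThreeQubits :=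
  tensorOp fun l => if l = i then pauliZ else 1

/-- For `i ≠ j`: `X` on the qubits `i` and `j` and `Z` on the remaining qubit. -/
def XXZ (i j : Fin 3) : ThreeQubits →L[ℂ] ThreeQubits :=
  tensorOp fun l => if l = i ∨ l = j then pauliX else pauliZ

/-- The computational basis vector `|a b c⟩`. -/
def ket (a b c : Fin 2) : ThreeQubits := EuclideanSpace.single ![a, b, c] 1

/-- The graph state of the complete graph on three vertices. -/
def G₃ : ThreeQubits :=
  ((1 / Real.sqrt 8 : ℝ) : ℂ) •
    (ket 0 0 0 + ket 1 0 0 + ket 0 1 0 - ket 1 1 0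
      + ket 0 0 1 - ket 1 0 1 - ket 0 1 1 - ket 1 1 1)

end

end TemporalSelfTest

/-! A sequential correlation is the average of `(inner ℂ ψ (w.prod ψ)).re` over the words `w` of the
nested anticommutator (`seqCorr_eq_sum_seqWords`). Words in dichotomic observables are isometries,
so every term is at most 1 in absolute value, and a term equals `s = ±1` only if the word maps `ψ`
to `s ψ`. The value 10 therefore saturates all ten correlators, and since the orders are complete,
the product in every order maps `ψ` to `±ψ` (`prod_apply_eq_smul`).

Having all orders replaces commutation. Moving involutions to the other side yields the relations
`GraphRelations` (`GraphRelations.of_allOrders`), by which every observable permutes the eight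
vectors `graphVec` up to sign. The same relations make these vectors orthonormal: an inner product
with `ψ` equals its own negative, and the other pairs are carried to such products
(`orthonormal_graphVec`).

The Pauli operators and `G₃` satisfy the same relations (`graphRelations_G₃`), hence act by the same
signed permutations on their own eight vectors. The unitary matches the two bases
(`equiv_compress_apply`). -/

namespace TemporalSelfTest

/-! ### Sequential correlations as averages over words, and their extremal values -/

section Words

variable {H : Type*} [NormedAddCommGroup H] [InnerProductSpace ℂ H]

/-- Post-measurement states are unnormalized, so conditioning on the first outcome needs no division
by its probability. -/
theorem seqCorr_succ {n : ℕ} (M : Fin (n + 1) → (H →L[ℂ] H)) (ψ : H) :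
    seqCorr M ψ = ∑ c : ℤˣ, ((c : ℤ) : ℝ) *
      seqCorr (fun i => M i.succ) (outcomeProj (M 0) c ψ) := by
  simp only [seqCorr, outcomeProb, Finset.mul_sum]
  rw [← Fintype.sum_prod_type', ← (Fin.consEquiv fun _ => ℤˣ).sum_comp]
  refine Finset.sum_congr rfl fun x _ => ?_
  simp [Fin.prod_univ_succ, postState, Fin.consEquiv, List.ofFn_succ, mul_assoc]

theorem mul_re_inner_le_one {s : ℝ} (hs : |s| = 1) {ψ φ : H} (hψ : ‖ψ‖ = 1) (hφ : ‖φ‖ = 1) :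
    s * (inner ℂ ψ φ).re ≤ 1 := by
  refine (le_abs_self _).trans ?_
  rw [abs_mul, hs, one_mul]
  refine (Complex.abs_re_le_norm _).trans ((norm_inner_le_norm _ _).trans ?_)
  rw [hψ, hφ, one_mul]

/-- The equality case of Cauchy–Schwarz: `‖s ψ - φ‖² = 1 - 2 + 1 = 0`. -/
theorem eq_smul_of_mul_re_inner_eq_one {s : ℝ} (hs : |s| = 1) {ψ φ : H} (hψ : ‖ψ‖ = 1)
    (hφ : ‖φ‖ = 1) (h : s * (inner ℂ ψ φ).re = 1) : φ = (s : ℂ) • ψ := by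
  have h₁ := @norm_sub_sq ℂ H _ _ _ ((s : ℂ) • ψ) φ
  have h₂ : ‖(s : ℂ) • ψ‖ = 1 := by rw [norm_smul, hψ, mul_one, Complex.norm_real]; exact hs
  rw [h₂, hφ, inner_smul_left, Complex.conj_ofReal, RCLike.re_to_complex, Complex.re_ofReal_mul,
    h] at h₁
  norm_num at h₁
  exact (sub_eq_zero.1 h₁).symm

variable [CompleteSpace H]

theorem IsDichotomic.inner_apply {C : H →L[ℂ] H} (hC : IsDichotomic C) (x y : H) :
    inner ℂ (C x) y = inner ℂ x (C y) :=
  hC.1.isSymmetric x y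

theorem IsDichotomic.apply_apply {C : H →L[ℂ] H} (hC : IsDichotomic C) (x : H) :
    C (C x) = x := by
  simpa using congrArg (fun T : H →L[ℂ] H => T x) hC.2

theorem IsDichotomic.inner_apply_apply {C : H →L[ℂ] H} (hC : IsDichotomic C) (x y : H) :
    inner ℂ (C x) (C y) = inner ℂ x y := by
  rw [hC.inner_apply, hC.apply_apply]

theorem IsDichotomic.norm_apply {C : H →L[ℂ] H} (hC : IsDichotomic C) (x : H) :
    ‖C x‖ = ‖x‖ := by
  rw [@norm_eq_sqrt_re_inner ℂ, @norm_eq_sqrt_re_inner ℂ _ _ _ _ x, hC.inner_apply_apply]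

theorem IsDichotomic.apply_eq_iff {C : H →L[ℂ] H} (hC : IsDichotomic C) {x y : H} :
    C x = y ↔ x = C y :=
  ⟨fun h => by rw [← h, hC.apply_apply], fun h => by rw [h, hC.apply_apply]⟩

theorem norm_list_prod_apply (l : List (H →L[ℂ] H)) (hl : ∀ C ∈ l, IsDichotomic C) (x : H) :
    ‖l.prod x‖ = ‖x‖ := by
  induction l with
  | nil => simp
  | cons C l ih =>
    rw [List.prod_cons, mul_apply_eq_comp, (hl C (by simp)).norm_apply,
      ih fun D hD => hl D (by simp [hD])]

/-- Averaging `c ⟪P_c ψ, W P_c ψ⟫` over the outcomes of `C` gives half an anticommutator. -/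
theorem sum_inner_outcomeProj {C : H →L[ℂ] H} (hC : IsDichotomic C) (W : H →L[ℂ] H) (ψ : H) :
    ∑ c : ℤˣ, ((c : ℤ) : ℝ) *
        (inner ℂ (outcomeProj C c ψ) (W (outcomeProj C c ψ))).re
      = 1 / 2 * ((inner ℂ ψ (C (W ψ))).re + (inner ℂ ψ (W (C ψ))).re) := by
  -- In the expansion of `P_c W P_c` only the terms odd in `c` survive the signed sum, namely those
  -- with a single factor `C`.
  rw [← hC.inner_apply]
  simp [outcomeProj]
  ring

/-- The exponent is `n`, not `n - 1`: the recursion starts at the empty word, to which the last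
letter is both prepended and appended, so each word is listed twice. Hence the factor `(1 / 2) ^ n`
in the correlations. -/
theorem length_seqWords {α : Type*} (l : List α) : (seqWords l).length = 2 ^ l.length := by
  induction l with
  | nil => rfl
  | cons a l ih => simp [seqWords, ih, pow_succ]; ring

theorem seqWords_map {α β : Type*} (f : α → β) (l : List α) :
    seqWords (l.map f) = (seqWords l).map (List.map f) := by
  induction l with
  | nil => rfl
  | cons a l ih => simp [seqWords, ih, Function.comp_def]

theorem mem_of_mem_seqWords {α : Type*} {l w : List α} (hw : w ∈ seqWords l) {a : α}
    (ha : a ∈ w) : a ∈ l := by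
  induction l generalizing w with
  | nil => simp_all [seqWords]
  | cons b l ih =>
    simp only [seqWords, List.mem_append, List.mem_map] at hw
    rcases hw with ⟨u, hu, rfl⟩ | ⟨u, hu, rfl⟩ <;> simp at ha ⊢ <;> grind

theorem list_sum_finset_sum {α ι : Type*} (l : List α) (s : Finset ι) (f : ι → α → ℝ) :
    ∑ c ∈ s, (l.map (f c)).sum = (l.map fun a => ∑ c ∈ s, f c a).sum := by
  induction l with
  | nil => simp
  | cons a l ih => simp [Finset.sum_add_distrib, ih]

/-- A sequential correlation is the average of the expectation values of the words of the nested
anticommutator. -/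
theorem seqCorr_eq_sum_seqWords {n : ℕ} (M : Fin n → (H →L[ℂ] H)) (hM : ∀ i, IsDichotomic (M i))
    (ψ : H) :
    seqCorr M ψ = (1 / 2) ^ n *
      ((seqWords (List.ofFn M)).map fun w => (inner ℂ ψ (w.prod ψ)).re).sum := by
  induction n generalizing ψ with
  | zero =>
    simp [seqCorr, outcomeProb, postState, seqWords, ← Complex.ofReal_pow]
  | succ n ih =>
    rw [seqCorr_succ]
    simp only [ih (fun i => M i.succ) fun i => hM _]
    have h := list_sum_finset_sum (seqWords (List.ofFn fun i => M i.succ)) Finset.univ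
      fun (c : ℤˣ) w => ((c : ℤ) : ℝ) *
        (inner ℂ (outcomeProj (M 0) c ψ) (w.prod (outcomeProj (M 0) c ψ))).re
    simp only [sum_inner_outcomeProj (hM 0), List.sum_map_mul_left, List.sum_map_add] at h
    simp only [mul_left_comm _ ((1 / 2 : ℝ) ^ n)]
    rw [← Finset.mul_sum, h]
    simp [List.ofFn_succ, seqWords, Function.comp_def]
    ring

theorem list_sum_le_length (l : List ℝ) (h : ∀ x ∈ l, x ≤ 1) : l.sum ≤ l.length := by
  simpa using List.sum_le_card_nsmul l 1 h

theorem eq_one_of_list_sum_eq_length (l : List ℝ) (h : ∀ x ∈ l, x ≤ 1) (hl : l.sum = l.length) :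
    ∀ x ∈ l, x = 1 := by
  induction l with
  | nil => simp
  | cons a l ih =>
    have h₁ := h a (by simp)
    have h₂ := list_sum_le_length l fun x hx => h x (by simp [hx])
    simp only [List.sum_cons, List.length_cons, Nat.cast_add, Nat.cast_one] at hl
    intro x hx
    rcases List.mem_cons.1 hx with rfl | hx
    · linarith
    · exact ih (fun x hx => h x (by simp [hx])) (by linarith) x hx

variable {n : ℕ} {M : Fin n → (H →L[ℂ] H)} {ψ : H} {s : ℝ}

theorem mul_seqCorr_eq (hM : ∀ i, IsDichotomic (M i)) :
    s * seqCorr M ψ = (1 / 2) ^ n *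
      ((seqWords (List.ofFn M)).map fun w => s * (inner ℂ ψ (w.prod ψ)).re).sum := by
  rw [seqCorr_eq_sum_seqWords M hM, List.sum_map_mul_left]
  ring

theorem norm_word_apply (hM : ∀ i, IsDichotomic (M i)) (hψ : ‖ψ‖ = 1) {w : List (H →L[ℂ] H)}
    (hw : w ∈ seqWords (List.ofFn M)) : ‖w.prod ψ‖ = 1 := by
  rw [norm_list_prod_apply w _ ψ, hψ]
  intro C hC
  obtain ⟨i, rfl⟩ := (List.mem_ofFn' _ _).1 (mem_of_mem_seqWords hw hC)
  exact hM i

theorem word_le_one (hM : ∀ i, IsDichotomic (M i)) (hψ : ‖ψ‖ = 1) (hs : |s| = 1) :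
    ∀ x ∈ (seqWords (List.ofFn M)).map fun w => s * (inner ℂ ψ (w.prod ψ)).re, x ≤ 1 := by
  intro x hx
  obtain ⟨w, hw, rfl⟩ := List.mem_map.1 hx
  exact mul_re_inner_le_one hs hψ (norm_word_apply hM hψ hw)

theorem mul_seqCorr_le_one (hM : ∀ i, IsDichotomic (M i)) (hψ : ‖ψ‖ = 1) (hs : |s| = 1) :
    s * seqCorr M ψ ≤ 1 := by
  have h := list_sum_le_length _ (word_le_one hM hψ hs)
  rw [List.length_map, length_seqWords, List.length_ofFn] at h
  rw [mul_seqCorr_eq hM]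
  calc _ ≤ (1 / 2 : ℝ) ^ n * ((2 ^ n : ℕ) : ℝ) := by gcongr
    _ = 1 := by rw [Nat.cast_pow, ← mul_pow]; norm_num

theorem word_apply_eq_smul (hM : ∀ i, IsDichotomic (M i)) (hψ : ‖ψ‖ = 1) (hs : |s| = 1)
    (h : s * seqCorr M ψ = 1) {w : List (H →L[ℂ] H)} (hw : w ∈ seqWords (List.ofFn M)) :
    w.prod ψ = (s : ℂ) • ψ := by
  refine eq_smul_of_mul_re_inner_eq_one hs hψ (norm_word_apply hM hψ hw) ?_
  refine eq_one_of_list_sum_eq_length _ (word_le_one hM hψ hs) ?_ _ (List.mem_map_of_mem hw)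
  rw [List.length_map, length_seqWords, List.length_ofFn]
  rw [mul_seqCorr_eq hM, one_div, inv_pow, inv_mul_eq_one₀ (by positivity)] at h
  rw [← h]; simp

theorem OrderSet.card_pos (S : OrderSet n) : (0 : ℝ) < S.1.card := by
  -- Some order in `S` has to cover the identity, so `S` is nonempty.
  obtain ⟨σ, hσ, -⟩ := S.2 1
  exact_mod_cast Finset.card_pos.2 ⟨σ, hσ⟩

theorem mul_permCorr_le_one (S : OrderSet n) (hM : ∀ i, IsDichotomic (M i)) (hψ : ‖ψ‖ = 1)
    (hs : |s| = 1) : s * permCorr S M ψ ≤ 1 := by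
  have hS := S.card_pos
  rw [permCorr, mul_left_comm, inv_mul_le_one₀ hS, Finset.mul_sum]
  simpa using Finset.sum_le_card_nsmul S.1 _ 1
    fun σ _ => mul_seqCorr_le_one (fun i => hM (σ i)) hψ hs

/-- An average of numbers at most 1 equals 1 only if each of them does. -/
theorem mul_seqCorr_eq_one_of_permCorr (S : OrderSet n) (hM : ∀ i, IsDichotomic (M i))
    (hψ : ‖ψ‖ = 1) (hs : |s| = 1) (h : s * permCorr S M ψ = 1) :
    ∀ σ ∈ S.1, s * seqCorr (fun i => M (σ i)) ψ = 1 := by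
  have hS := S.card_pos
  rw [permCorr, mul_left_comm, inv_mul_eq_one₀ hS.ne', Finset.mul_sum] at h
  have h₁ := (Finset.sum_eq_sum_iff_of_le (s := S.1) (g := fun _ => (1 : ℝ))
    (f := fun σ => s * seqCorr (fun i => M (σ i)) ψ)
    fun σ _ => mul_seqCorr_le_one (fun i => hM (σ i)) hψ hs).1
  apply h₁
  rw [← h, Finset.sum_const, nsmul_eq_mul, mul_one]

/-- If a correlator takes its extremal value `s = ±1`, then the product of the observables in any
order maps `ψ` to `s ψ`. -/
theorem prod_apply_eq_smul (S : OrderSet n) (hM : ∀ i, IsDichotomic (M i)) (hψ : ‖ψ‖ = 1)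
    (hs : |s| = 1) (h : s * permCorr S M ψ = 1) (f : Fin n → Fin n) (hf : f.Injective) :
    (List.ofFn fun i => M (f i)).prod ψ = (s : ℂ) • ψ := by
  obtain ⟨σ, hσ, hw⟩ := S.2 (Equiv.ofBijective f (Finite.injective_iff_bijective.1 hf))
  refine word_apply_eq_smul (fun i => hM (σ i)) hψ hs
    (mul_seqCorr_eq_one_of_permCorr S hM hψ hs h σ hσ) ?_
  -- Completeness concerns words of indices; mapping along `M` turns them into words of operators.
  have h₁ := List.mem_map_of_mem (f := List.map M) hw
  rwa [← seqWords_map, List.map_ofFn, List.map_ofFn] at h₁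

end Words

/-! ### Pauli operators on three qubits and the sign pattern of the graph state -/

theorem tensorOp_mul (σ τ : Fin 3 → Matrix (Fin 2) (Fin 2) ℂ) :
    tensorOp σ * tensorOp τ = tensorOp fun l => σ l * τ l := by
  rw [tensorOp, tensorOp, ← map_mul, tensorOp]
  congr 1
  ext x y
  simp only [Matrix.mul_apply, Matrix.of_apply, ← Finset.prod_mul_distrib, Finset.prod_univ_sum,
    Fintype.piFinset_univ]

theorem tensorOp_one : tensorOp (fun _ => 1) = 1 := by
  rw [tensorOp, ← map_one (Matrix.toEuclideanCLM (𝕜 := ℂ) (n := Fin 3 → Fin 2))]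
  congr 1
  ext x y
  simp [Matrix.one_apply, Finset.prod_ite_zero, funext_iff]

theorem isDichotomic_tensorOp {σ : Fin 3 → Matrix (Fin 2) (Fin 2) ℂ}
    (hσ : ∀ l, (σ l).IsHermitian) (hσ' : ∀ l, σ l * σ l = 1) : IsDichotomic (tensorOp σ) := by
  refine ⟨?_, ?_⟩
  · rw [IsSelfAdjoint, tensorOp, ← map_star]
    congr 1
    ext x y
    simp only [Matrix.star_apply, Matrix.of_apply, star_prod, (hσ _).apply]
  · simp only [tensorOp_mul, hσ', tensorOp_one]

theorem pauliX_isHermitian : pauliX.IsHermitian := by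
  ext i j; fin_cases i <;> fin_cases j <;> simp [pauliX]

theorem pauliZ_isHermitian : pauliZ.IsHermitian := by
  ext i j; fin_cases i <;> fin_cases j <;> simp [pauliZ]

theorem pauliX_mul_self : pauliX * pauliX = 1 := by
  ext i j; fin_cases i <;> fin_cases j <;> simp [pauliX]

theorem pauliZ_mul_self : pauliZ * pauliZ = 1 := by
  ext i j; fin_cases i <;> fin_cases j <;> simp [pauliZ]

theorem isDichotomic_X (i : Fin 3) : IsDichotomic (X i) := by
  refine isDichotomic_tensorOp (fun l => ?_) fun l => ?_ <;> split_ifs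
  exacts [pauliX_isHermitian, Matrix.isHermitian_one, pauliX_mul_self, one_mul 1]

theorem isDichotomic_Z (i : Fin 3) : IsDichotomic (Z i) := by
  refine isDichotomic_tensorOp (fun l => ?_) fun l => ?_ <;> split_ifs
  exacts [pauliZ_isHermitian, Matrix.isHermitian_one, pauliZ_mul_self, one_mul 1]

theorem isDichotomic_XXZ (i j : Fin 3) : IsDichotomic (XXZ i j) := by
  refine isDichotomic_tensorOp (fun l => ?_) fun l => ?_ <;> split_ifs
  exacts [pauliX_isHermitian, pauliZ_isHermitian, pauliX_mul_self, pauliZ_mul_self]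

theorem tensorOp_apply (σ : Fin 3 → Matrix (Fin 2) (Fin 2) ℂ) (φ : ThreeQubits)
    (x : Fin 3 → Fin 2) : tensorOp σ φ x = ∑ y, (∏ l, σ l (x l) (y l)) * φ y := by
  simp only [tensorOp, Matrix.ofLp_toEuclideanCLM, Matrix.mulVec, dotProduct, Matrix.of_apply]

/-- `X i` flips the `i`-th bit. -/
theorem X_apply (i : Fin 3) (φ : ThreeQubits) (x : Fin 3 → Fin 2) :
    X i φ x = φ (Function.update x i (1 - x i)) := by
  have h (y : Fin 3 → Fin 2) :
      ∏ l, (if l = i then pauliX else 1 : Matrix (Fin 2) (Fin 2) ℂ) (x l) (y l)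
        = if Function.update x i (1 - x i) = y then 1 else 0 := by
    have h₁ (l : Fin 3) : (if l = i then pauliX else 1 : Matrix (Fin 2) (Fin 2) ℂ) (x l) (y l)
        = if Function.update x i (1 - x i) l = y l then 1 else 0 := by
      by_cases hl : l = i
      · subst hl
        generalize x l = a, y l = b
        fin_cases a <;> fin_cases b <;> simp [pauliX]
      · simp [hl, Matrix.one_apply]
    simp only [h₁, Finset.prod_ite_zero, Finset.prod_const_one, Finset.mem_univ, true_imp_iff,
      funext_iff]
  simp [X, tensorOp_apply, h]

/-- `Z i` multiplies by the sign of the `i`-th bit. -/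
theorem Z_apply (i : Fin 3) (φ : ThreeQubits) (x : Fin 3 → Fin 2) :
    Z i φ x = (if x i = 0 then 1 else -1) * φ x := by
  have h (y : Fin 3 → Fin 2) :
      ∏ l, (if l = i then pauliZ else 1 : Matrix (Fin 2) (Fin 2) ℂ) (x l) (y l)
        = if x = y then (if x i = 0 then 1 else -1) else 0 := by
    have h₁ (l : Fin 3) : (if l = i then pauliZ else 1 : Matrix (Fin 2) (Fin 2) ℂ) (x l) (y l)
        = if x l = y l then (if l = i then (if x i = 0 then 1 else -1) else 1) else 0 := by
      by_cases hl : l = i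
      · subst hl
        generalize x l = a, y l = b
        fin_cases a <;> fin_cases b <;> simp [pauliZ]
      · simp [hl, Matrix.one_apply]
    simp only [h₁, Finset.prod_ite_zero, Finset.prod_ite_eq', Finset.mem_univ, true_imp_iff,
      funext_iff, if_true]
  simp [Z, tensorOp_apply, h]

theorem XXZ_eq_mul {i j k : Fin 3} (hij : i ≠ j) (hik : i ≠ k) (hjk : j ≠ k) :
    XXZ i j = X i * X j * Z k := by
  simp only [XXZ, X, Z, tensorOp_mul]
  congr 1
  funext l
  have : l = i ∨ l = j ∨ l = k := by omega
  rcases this with rfl | rfl | rfl <;> simp [*, Ne.symm]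

/-- The vector of three qubits with amplitudes `s x / √8`. -/
noncomputable def signVec (s : (Fin 3 → Fin 2) → ℤ) : ThreeQubits :=
  WithLp.toLp 2 fun x => ((1 / Real.sqrt 8 : ℝ) : ℂ) * (s x : ℂ)

theorem X_signVec (i : Fin 3) (s : (Fin 3 → Fin 2) → ℤ) :
    X i (signVec s) = signVec fun x => s (Function.update x i (1 - x i)) := by
  ext x
  simp [X_apply, signVec]

theorem Z_signVec (i : Fin 3) (s : (Fin 3 → Fin 2) → ℤ) :
    Z i (signVec s) = signVec fun x => (if x i = 0 then 1 else -1) * s x := by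
  ext x
  simp [Z_apply, signVec]

theorem neg_signVec (s : (Fin 3 → Fin 2) → ℤ) : -signVec s = signVec fun x => -s x := by
  ext x
  simp [signVec]

/-- The signs of the amplitudes of the complete-graph state. -/
def graphSign (x : Fin 3 → Fin 2) : ℤ :=
  if x 0 = 0 then (if x 1 = 1 ∧ x 2 = 1 then -1 else 1)
  else (if x 1 = 0 ∧ x 2 = 0 then 1 else -1)

theorem G₃_eq_signVec : G₃ = signVec graphSign := by
  ext x
  obtain ⟨a, b, c, rfl⟩ : ∃ a b c, x = ![a, b, c] :=
    ⟨x 0, x 1, x 2, by ext l; fin_cases l <;> rfl⟩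
  fin_cases a <;> fin_cases b <;> fin_cases c <;>
    simp [G₃, ket, signVec, graphSign]

theorem norm_G₃ : ‖G₃‖ = 1 := by
  have h (x) : ‖G₃ x‖ ^ 2 = 1 / 8 := by
    rw [G₃_eq_signVec]
    have : graphSign x = 1 ∨ graphSign x = -1 := by unfold graphSign; split_ifs <;> simp
    rcases this with h | h <;> simp [signVec, h]
  rw [EuclideanSpace.norm_eq, Finset.sum_congr rfl fun x _ => h x]
  simp

theorem neg_one_fin_three : (-1 : Fin 3) = 2 := rfl

theorem neg_two_fin_three : (-2 : Fin 3) = 1 := rfl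

theorem left_ne_third {i j : Fin 3} (h : i ≠ j) : i ≠ -(i + j) := by
  revert i j; decide

theorem right_ne_third {i j : Fin 3} (h : i ≠ j) : j ≠ -(i + j) := by
  revert i j; decide

/-! ### Signed permutation action and orthonormality from the relations -/

section Relations

variable {H : Type*} [NormedAddCommGroup H] [InnerProductSpace ℂ H] [CompleteSpace H]

/-- The relations on a unit vector that characterize the complete-graph state. For `i ≠ j` in
`Fin 3` the third index is `-(i + j)`. -/
structure GraphRelations (A B : Fin 3 → (H →L[ℂ] H)) (M : Fin 3 → Fin 3 → (H →L[ℂ] H)) (ψ : H) :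
    Prop where
  norm_eq_one : ‖ψ‖ = 1
  dichotomic_A : ∀ i, IsDichotomic (A i)
  dichotomic_B : ∀ i, IsDichotomic (B i)
  dichotomic_M : ∀ i j, i ≠ j → IsDichotomic (M i j)
  A_A : ∀ i j, i ≠ j → A i (A j ψ) = -A (-(i + j)) ψ
  A_B : ∀ i j, i ≠ j → A i (B j ψ) = B (-(i + j)) ψ
  B_A : ∀ i j, i ≠ j → B i (A j ψ) = B (-(i + j)) ψ
  B_B : ∀ i j, i ≠ j → B i (B j ψ) = A (-(i + j)) ψ
  A_B_self : ∀ i, A i (B i ψ) = A 0 (B 0 ψ)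
  B_A_self : ∀ i, B i (A i ψ) = -A 0 (B 0 ψ)
  M_state : ∀ i j, i ≠ j → M i j ψ = A 0 (B 0 ψ)
  M_A_left : ∀ i j, i ≠ j → M i j (A i ψ) = B i ψ
  M_A_right : ∀ i j, i ≠ j → M i j (A j ψ) = B j ψ
  M_A_third : ∀ i j, i ≠ j → M i j (A (-(i + j)) ψ) = -B (-(i + j)) ψ

/-- The vectors that span `V₃`. -/
def graphVec (A B : Fin 3 → (H →L[ℂ] H)) (ψ : H) : Fin 8 → H :=
  ![ψ, A 0 ψ, A 1 ψ, A 2 ψ, B 0 ψ, B 1 ψ, B 2 ψ, A 0 (B 0 ψ)]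

/-- The signed permutation by which `A i` acts on the vectors `graphVec`. -/
def actA : Fin 3 → Fin 8 → ℤ × Fin 8 :=
  ![![(1, 1), (1, 0), (-1, 3), (-1, 2), (1, 7), (1, 6), (1, 5), (1, 4)],
    ![(1, 2), (-1, 3), (1, 0), (-1, 1), (1, 6), (1, 7), (1, 4), (1, 5)],
    ![(1, 3), (-1, 2), (-1, 1), (1, 0), (1, 5), (1, 4), (1, 7), (1, 6)]]

/-- The signed permutation by which `B i` acts on the vectors `graphVec`. -/
def actB : Fin 3 → Fin 8 → ℤ × Fin 8 :=
  ![![(1, 4), (-1, 7), (1, 6), (1, 5), (1, 0), (1, 3), (1, 2), (-1, 1)],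
    ![(1, 5), (1, 6), (-1, 7), (1, 4), (1, 3), (1, 0), (1, 1), (-1, 2)],
    ![(1, 6), (1, 5), (1, 4), (-1, 7), (1, 2), (1, 1), (1, 0), (-1, 3)]]

/-- The signed permutation by which `M i j` acts on the vectors `graphVec`, where `k` is the third
index. -/
def actM : Fin 3 → Fin 8 → ℤ × Fin 8 :=
  ![![(1, 7), (-1, 4), (1, 5), (1, 6), (-1, 1), (1, 2), (1, 3), (1, 0)],
    ![(1, 7), (1, 4), (-1, 5), (1, 6), (1, 1), (-1, 2), (1, 3), (1, 0)],
    ![(1, 7), (1, 4), (1, 5), (-1, 6), (1, 1), (1, 2), (-1, 3), (1, 0)]]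

namespace GraphRelations

variable {A B : Fin 3 → (H →L[ℂ] H)} {M : Fin 3 → Fin 3 → (H →L[ℂ] H)} {ψ : H}

theorem A_apply_A_B (h : GraphRelations A B M ψ) (i : Fin 3) : A i (A 0 (B 0 ψ)) = B i ψ := by
  rw [← h.A_B_self i, (h.dichotomic_A i).apply_apply]

theorem B_apply_A_B (h : GraphRelations A B M ψ) (i : Fin 3) : B i (A 0 (B 0 ψ)) = -A i ψ := by
  rw [(h.dichotomic_B i).apply_eq_iff, map_neg, h.B_A_self, neg_neg]

theorem A_graphVec (h : GraphRelations A B M ψ) (i : Fin 3) (a : Fin 8) :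
    A i (graphVec A B ψ a) = ((actA i a).1 : ℂ) • graphVec A B ψ (actA i a).2 := by
  fin_cases i <;> fin_cases a <;>
    simp [graphVec, actA, (h.dichotomic_A _).apply_apply, h.A_A, h.A_B, h.A_B_self, h.A_apply_A_B,
      neg_one_fin_three, neg_two_fin_three]

theorem B_graphVec (h : GraphRelations A B M ψ) (i : Fin 3) (a : Fin 8) :
    B i (graphVec A B ψ a) = ((actB i a).1 : ℂ) • graphVec A B ψ (actB i a).2 := by
  fin_cases i <;> fin_cases a <;>
    simp [graphVec, actB, (h.dichotomic_B _).apply_apply, h.B_A, h.B_B, h.B_A_self, h.B_apply_A_B,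
      neg_one_fin_three, neg_two_fin_three]

theorem M_graphVec (h : GraphRelations A B M ψ) {i j : Fin 3} (hij : i ≠ j) (a : Fin 8) :
    M i j (graphVec A B ψ a)
      = ((actM (-(i + j)) a).1 : ℂ) • graphVec A B ψ (actM (-(i + j)) a).2 := by
  have hM := h.dichotomic_M i j hij
  have h₀ := h.M_state i j hij
  have h₁ := h.M_A_left i j hij
  have h₂ := h.M_A_right i j hij
  have h₃ := h.M_A_third i j hij
  -- `M i j` is an involution, so the images of `ψ` and the `A l ψ` also determine those of the
  -- other four vectors.
  have h₀' := hM.apply_eq_iff.1 h₀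
  have h₁' := hM.apply_eq_iff.1 h₁
  have h₂' := hM.apply_eq_iff.1 h₂
  have h₃' := neg_eq_iff_eq_neg.2 (((hM.apply_eq_iff.1 h₃).trans (map_neg _ _)))
  fin_cases i <;> fin_cases j <;> first | exact absurd rfl hij | skip
  all_goals
    simp [neg_one_fin_three, neg_two_fin_three] at h₀ h₁ h₂ h₃ h₀' h₁' h₂' h₃'
    fin_cases a <;>
      simp [graphVec, actM, neg_one_fin_three, neg_two_fin_three, h₀, h₁, h₂, h₃, ← h₀', ← h₁', ← h₂', ← h₃']

/-- The isometry `B k B i` takes the pair `ψ`, `A i ψ` to `A j ψ`, `A k ψ`, and the minus sign in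
`A_A` then shows that the inner product is its own negative. -/
theorem inner_state_A (h : GraphRelations A B M ψ) (i : Fin 3) : inner ℂ ψ (A i ψ) = 0 := by
  obtain ⟨j, k, hjk, hki, h₁, h₂⟩ :
      ∃ j k : Fin 3, j ≠ k ∧ k ≠ i ∧ -(j + k) = i ∧ -(k + i) = j := by
    revert i; decide
  refine self_eq_neg.1 ?_
  calc inner ℂ ψ (A i ψ) = inner ℂ (B k (B i ψ)) (B k (B i (A i ψ))) := by
        rw [(h.dichotomic_B k).inner_apply_apply, (h.dichotomic_B i).inner_apply_apply]
    _ = inner ℂ ψ (A j (A k ψ)) := by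
        rw [h.B_B k i hki, h₂, h.B_A_self, map_neg, h.B_apply_A_B, neg_neg,
          (h.dichotomic_A j).inner_apply]
    _ = -inner ℂ ψ (A i ψ) := by rw [h.A_A j k hjk, h₁, inner_neg_right]

theorem inner_state_B (h : GraphRelations A B M ψ) (i : Fin 3) : inner ℂ ψ (B i ψ) = 0 := by
  obtain ⟨j, k, hji, hik, hij, hkj, h₁, h₂, h₃, h₄⟩ :
      ∃ j k : Fin 3, j ≠ i ∧ i ≠ k ∧ i ≠ j ∧ k ≠ j ∧ -(j + i) = k ∧ -(i + k) = j ∧ -(i + j) = k ∧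
        -(k + j) = i := by
    revert i; decide
  refine self_eq_neg.1 ?_
  calc inner ℂ ψ (B i ψ) = inner ℂ (A i (A j ψ)) (A i (A j (B i ψ))) := by
        rw [(h.dichotomic_A i).inner_apply_apply, (h.dichotomic_A j).inner_apply_apply]
    _ = -inner ℂ ψ (A k (B j ψ)) := by
        rw [h.A_A i j hij, h.A_B j i hji, h₁, h₃, h.A_B i k hik, h₂, inner_neg_left,
          (h.dichotomic_A k).inner_apply]
    _ = -inner ℂ ψ (B i ψ) := by rw [h.A_B k j hkj, h₄]

/-- Anticommutation of `A 0` and `B 0` on `ψ` only makes this number purely imaginary. It is also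
real, being the expectation value of the self-adjoint `M 0 1`. -/
theorem inner_state_A_B (h : GraphRelations A B M ψ) : inner ℂ ψ (A 0 (B 0 ψ)) = 0 := by
  have hM := h.dichotomic_M 0 1 (by decide)
  refine self_eq_neg.1 ?_
  calc inner ℂ ψ (A 0 (B 0 ψ)) = inner ℂ (B 0 ψ) (B 0 (A 0 (B 0 ψ))) :=
        ((h.dichotomic_B 0).inner_apply_apply _ _).symm
    _ = -inner ℂ (M 0 1 ψ) ψ := by
        rw [h.B_apply_A_B, inner_neg_right, ← (h.dichotomic_A 0).inner_apply, h.M_state 0 1 (by decide)]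
    _ = -inner ℂ ψ (A 0 (B 0 ψ)) := by rw [hM.inner_apply, h.M_state 0 1 (by decide)]

theorem inner_state_graphVec (h : GraphRelations A B M ψ) {b : Fin 8} (hb : b ≠ 0) :
    inner ℂ ψ (graphVec A B ψ b) = 0 := by
  fin_cases b
  exacts [absurd rfl hb, h.inner_state_A 0, h.inner_state_A 1, h.inner_state_A 2,
    h.inner_state_B 0, h.inner_state_B 1, h.inner_state_B 2, h.inner_state_A_B]

theorem orthonormal_graphVec (h : GraphRelations A B M ψ) : Orthonormal ℂ (graphVec A B ψ) := by
  -- An isometry sending the `a`-th vector to `ψ` and the `b`-th to a multiple of a vector other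
  -- than `ψ` reduces the pair to an inner product with `ψ`.
  have move {T : H →L[ℂ] H} (hT : IsDichotomic T) {act : Fin 8 → ℤ × Fin 8}
      (ht : ∀ a, T (graphVec A B ψ a) = ((act a).1 : ℂ) • graphVec A B ψ (act a).2) {a : Fin 8}
      (ha : act a = (1, 0)) (hb : ∀ b, a ≠ b → (act b).2 ≠ 0) {b : Fin 8} (hab : a ≠ b) :
      inner ℂ (graphVec A B ψ a) (graphVec A B ψ b) = 0 := by
    rw [← hT.inner_apply_apply, ht, ht, ha, inner_smul_left, inner_smul_right,
      show graphVec A B ψ (1, (0 : Fin 8)).2 = ψ from rfl, h.inner_state_graphVec (hb b hab),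
      mul_zero, mul_zero]
  refine ⟨fun a => ?_, fun a b hab => ?_⟩
  · fin_cases a <;> simp [graphVec, (h.dichotomic_A _).norm_apply, (h.dichotomic_B _).norm_apply,
      h.norm_eq_one]
  · fin_cases a
    · exact h.inner_state_graphVec hab.symm
    · exact move (h.dichotomic_A 0) (h.A_graphVec 0) rfl (by decide) hab
    · exact move (h.dichotomic_A 1) (h.A_graphVec 1) rfl (by decide) hab
    · exact move (h.dichotomic_A 2) (h.A_graphVec 2) rfl (by decide) hab
    · exact move (h.dichotomic_B 0) (h.B_graphVec 0) rfl (by decide) hab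
    · exact move (h.dichotomic_B 1) (h.B_graphVec 1) rfl (by decide) hab
    · exact move (h.dichotomic_B 2) (h.B_graphVec 2) rfl (by decide) hab
    · exact move (h.dichotomic_M 0 1 (by decide)) (h.M_graphVec (by decide)) rfl (by decide) hab

end GraphRelations

end Relations

/-- All vectors involved have amplitudes `±1/√8`, so each relation between them is an equality of
integer sign functions on eight bit strings, which is decidable. -/
theorem graphRelations_G₃ : GraphRelations X Z XXZ G₃ where
  norm_eq_one := norm_G₃
  dichotomic_A := isDichotomic_X
  dichotomic_B := isDichotomic_Z
  dichotomic_M i j _ := isDichotomic_XXZ i j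
  A_A i j hij := by
    simp only [G₃_eq_signVec, X_signVec, neg_signVec]
    congr 1; revert i j; decide
  A_B i j hij := by
    simp only [G₃_eq_signVec, X_signVec, Z_signVec]
    congr 1; revert i j; decide
  B_A i j hij := by
    simp only [G₃_eq_signVec, X_signVec, Z_signVec]
    congr 1; revert i j; decide
  B_B i j hij := by
    simp only [G₃_eq_signVec, X_signVec, Z_signVec]
    congr 1; revert i j; decide
  A_B_self i := by
    simp only [G₃_eq_signVec, X_signVec, Z_signVec]
    congr 1; revert i; decide
  B_A_self i := by
    simp only [G₃_eq_signVec, X_signVec, Z_signVec, neg_signVec]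
    congr 1; revert i; decide
  M_state i j hij := by
    rw [XXZ_eq_mul (k := -(i + j)) hij (left_ne_third hij) (right_ne_third hij)]
    simp only [mul_apply_eq_comp, G₃_eq_signVec, X_signVec, Z_signVec]
    congr 1; revert i j; decide
  M_A_left i j hij := by
    rw [XXZ_eq_mul (k := -(i + j)) hij (left_ne_third hij) (right_ne_third hij)]
    simp only [mul_apply_eq_comp, G₃_eq_signVec, X_signVec, Z_signVec]
    congr 1; revert i j; decide
  M_A_right i j hij := by
    rw [XXZ_eq_mul (k := -(i + j)) hij (left_ne_third hij) (right_ne_third hij)]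
    simp only [mul_apply_eq_comp, G₃_eq_signVec, X_signVec, Z_signVec]
    congr 1; revert i j; decide
  M_A_third i j hij := by
    rw [XXZ_eq_mul (k := -(i + j)) hij (left_ne_third hij) (right_ne_third hij)]
    simp only [mul_apply_eq_comp, G₃_eq_signVec, X_signVec, Z_signVec, neg_signVec]
    congr 1; revert i j; decide

/-! ### From products in all orders to the relations -/

section AllOrders

variable {H : Type*} [NormedAddCommGroup H] [InnerProductSpace ℂ H]

/-- The product of the operators in any order maps `ψ` to `s ψ`. -/
def AllOrders {n : ℕ} (M : Fin n → (H →L[ℂ] H)) (s : ℝ) (ψ : H) : Prop :=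
  ∀ f : Fin n → Fin n, f.Injective → (List.ofFn fun i => M (f i)).prod ψ = (s : ℂ) • ψ

variable {s : ℝ} {ψ : H} {a b c d : H →L[ℂ] H}

theorem AllOrders.apply_two (h : AllOrders ![a, b] s ψ) : a (b ψ) = (s : ℂ) • ψ := by
  simpa [List.ofFn_succ] using h id Function.injective_id

theorem AllOrders.apply_three (h : AllOrders ![a, b, c] s ψ) : a (b (c ψ)) = (s : ℂ) • ψ := by
  simpa [List.ofFn_succ] using h id Function.injective_id

theorem AllOrders.apply_four (h : AllOrders ![a, b, c, d] s ψ) :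
    a (b (c (d ψ))) = (s : ℂ) • ψ := by
  simpa [List.ofFn_succ] using h id Function.injective_id

theorem AllOrders.reorder {n : ℕ} {M N : Fin n → (H →L[ℂ] H)} (h : AllOrders M s ψ)
    (f : Fin n → Fin n) (hf : f.Injective) (hN : ∀ i, N i = M (f i)) : AllOrders N s ψ := by
  intro g hg
  simp only [hN]
  exact h (f ∘ g) (hf.comp hg)

theorem AllOrders.swap_three (h : AllOrders ![a, b, c] s ψ) : AllOrders ![b, a, c] s ψ :=
  h.reorder ![1, 0, 2] (by decide) fun i => by fin_cases i <;> rfl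

theorem AllOrders.rotate_three (h : AllOrders ![a, b, c] s ψ) : AllOrders ![b, c, a] s ψ :=
  h.reorder ![1, 2, 0] (by decide) fun i => by fin_cases i <;> rfl

theorem AllOrders.swap_four (h : AllOrders ![a, b, c, d] s ψ) : AllOrders ![b, a, c, d] s ψ :=
  h.reorder ![1, 0, 2, 3] (by decide) fun i => by fin_cases i <;> rfl

theorem AllOrders.rotate_four (h : AllOrders ![a, b, c, d] s ψ) : AllOrders ![b, c, d, a] s ψ :=
  h.reorder ![1, 2, 3, 0] (by decide) fun i => by fin_cases i <;> rfl

/-- `T₃` contains one correlator per cyclic triple; symmetry in the first two indices supplies the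
other three. -/
theorem forall_distinct {p : Fin 3 → Fin 3 → Fin 3 → Prop} (h₀ : p 0 1 2) (h₁ : p 1 2 0)
    (h₂ : p 2 0 1) (hp : ∀ i j k, p i j k → p j i k) {i j : Fin 3} (hij : i ≠ j) :
    p i j (-(i + j)) := by
  fin_cases i <;> fin_cases j <;> first | exact absurd rfl hij | skip
  exacts [h₀, hp _ _ _ h₂, hp _ _ _ h₀, h₁, h₂, hp _ _ _ h₁]

variable [CompleteSpace H]

/-- The relations hold as soon as the stabilizing products fix the state in every order. -/
theorem GraphRelations.of_allOrders {A B : Fin 3 → (H →L[ℂ] H)}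
    {M : Fin 3 → Fin 3 → (H →L[ℂ] H)} (hψ : ‖ψ‖ = 1)
    (hA : ∀ i, IsDichotomic (A i)) (hB : ∀ i, IsDichotomic (B i))
    (hM : ∀ i j, i ≠ j → IsDichotomic (M i j))
    (hAABM : ∀ i j, i ≠ j → AllOrders ![A i, A j, B (-(i + j)), M i j] 1 ψ)
    (hBBA : ∀ i j, i ≠ j → AllOrders ![B i, B j, A (-(i + j))] 1 ψ)
    (hAAA : ∀ i j, i ≠ j → AllOrders ![A i, A j, A (-(i + j))] (-1) ψ)
    (hMM : ∀ i j, i ≠ j → M i j ψ = M 0 1 ψ) : GraphRelations A B M ψ := by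
  have third₁ (i j : Fin 3) : -(-(i + j) + i) = j := by revert i j; decide
  have third₂ (i j : Fin 3) : -(-(i + j) + j) = i := by revert i j; decide
  have third₃ (i j : Fin 3) : -(j + -(i + j)) = i := by revert i j; decide
  have hAA (i j : Fin 3) (hij : i ≠ j) : A i (A j ψ) = -A (-(i + j)) ψ := by
    have h := (hAAA i j hij).rotate_three.rotate_three.apply_three
    rw [(hA _).apply_eq_iff] at h
    simpa using h
  have hAB (i j : Fin 3) (hij : i ≠ j) : A i (B j ψ) = B (-(i + j)) ψ := by
    have h := (hBBA _ j (right_ne_third hij).symm).swap_three.rotate_three.apply_three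
    rw [third₂, (hB _).apply_eq_iff] at h
    simpa using h
  have hBA (i j : Fin 3) (hij : i ≠ j) : B i (A j ψ) = B (-(i + j)) ψ := by
    have h := (hBBA _ i (left_ne_third hij).symm).apply_three
    rw [third₁, (hB _).apply_eq_iff] at h
    simpa using h
  have hBB (i j : Fin 3) (hij : i ≠ j) : B i (B j ψ) = A (-(i + j)) ψ := by
    have h := (hBBA i j hij).rotate_three.rotate_three.apply_three
    rw [(hA _).apply_eq_iff] at h
    simpa using h
  have hABs (i : Fin 3) : A i (B i ψ) = M 0 1 ψ := by
    obtain ⟨j, hij⟩ : ∃ j, i ≠ j := (exists_ne i).imp fun _ => Ne.symm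
    -- In the order `M A_i A_j B_k`, with `k` the third index, `A_j B_k ψ` collapses to `B_i ψ`,
    -- leaving `M A_i B_i ψ = ψ`.
    have h := (hAABM i j hij).rotate_four.rotate_four.rotate_four.apply_four
    rw [hAB j _ (right_ne_third hij), third₃, (hM i j hij).apply_eq_iff] at h
    simpa [hMM i j hij] using h
  have hBAs (k : Fin 3) : B k (A k ψ) = -M 0 1 ψ := by
    obtain ⟨i, j, hij, rfl⟩ : ∃ i j : Fin 3, i ≠ j ∧ -(i + j) = k := by revert k; decide
    -- In the order `M B_k A_i A_j` the collapse `A_i A_j ψ = -A_k ψ` gives the opposite sign: `A_k`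
    -- and `B_k` anticommute on `ψ`.
    have h := (hAABM i j hij).rotate_four.rotate_four.swap_four.apply_four
    rw [hAA i j hij, (hM i j hij).apply_eq_iff] at h
    simpa [hMM i j hij, neg_eq_iff_eq_neg] using h
  refine ⟨hψ, hA, hB, hM, hAA, hAB, hBA, hBB, fun i => ?_, fun i => ?_, fun i j hij => ?_,
    fun i j hij => ?_, fun i j hij => ?_, fun i j hij => ?_⟩
  · rw [hABs, hABs]
  · rw [hBAs, hABs]
  · rw [hABs, hMM i j hij]
  · have h := (hAABM i j hij).rotate_four.apply_four
    rw [(hA j).apply_eq_iff, (hB _).apply_eq_iff] at h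
    rwa [Complex.ofReal_one, one_smul, hBA _ j (right_ne_third hij).symm, third₂] at h
  · have h := (hAABM i j hij).swap_four.rotate_four.apply_four
    rw [(hA i).apply_eq_iff, (hB _).apply_eq_iff] at h
    rwa [Complex.ofReal_one, one_smul, hBA _ i (left_ne_third hij).symm, third₁] at h
  · have h := ((hAABM i j hij).reorder (N := ![A j, A i, M i j, B (-(i + j))]) ![1, 0, 3, 2]
      (by decide) fun l => by fin_cases l <;> rfl).apply_four
    rw [(hA j).apply_eq_iff, (hA i).apply_eq_iff, (hM i j hij).apply_eq_iff] at h
    rw [Complex.ofReal_one, one_smul, hAA i j hij, map_neg] at h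
    rw [h, neg_neg]

theorem allOrders_of_permCorr {n : ℕ} {M : Fin n → (H →L[ℂ] H)} (S : OrderSet n)
    (hM : ∀ i, IsDichotomic (M i)) (hψ : ‖ψ‖ = 1) (hs : |s| = 1) (h : s * permCorr S M ψ = 1) :
    AllOrders M s ψ :=
  prod_apply_eq_smul S hM hψ hs h

/-- The maximal value of `T₃` forces the relations of the complete-graph state. -/
theorem graphRelations_of_T₃_eq (π₄ : Fin 3 → OrderSet 4) (π₃ : Fin 4 → OrderSet 3)
    (π₂ : Fin 3 → OrderSet 2) (hψ : ‖ψ‖ = 1)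
    {A B : Fin 3 → (H →L[ℂ] H)} {M : Fin 3 → Fin 3 → (H →L[ℂ] H)}
    (hA : ∀ i, IsDichotomic (A i)) (hB : ∀ i, IsDichotomic (B i))
    (hM : ∀ i j, i ≠ j → IsDichotomic (M i j)) (hMsymm : ∀ i j, M i j = M j i)
    (hmax : T₃ π₄ π₃ π₂ A B M ψ = 10) : GraphRelations A B M ψ := by
  have hM₀ : IsDichotomic (M 0 1) := hM 0 1 (by decide)
  have hM₁ : IsDichotomic (M 2 0) := hM 2 0 (by decide)
  have hM₂ : IsDichotomic (M 1 2) := hM 1 2 (by decide)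
  have dich₄ {a b c d : H →L[ℂ] H} (ha : IsDichotomic a) (hb : IsDichotomic b)
      (hc : IsDichotomic c) (hd : IsDichotomic d) (i : Fin 4) :
      IsDichotomic (![a, b, c, d] i) := by
    fin_cases i <;> assumption
  have dich₃ {a b c : H →L[ℂ] H} (ha : IsDichotomic a) (hb : IsDichotomic b)
      (hc : IsDichotomic c) (i : Fin 3) : IsDichotomic (![a, b, c] i) := by
    fin_cases i <;> assumption
  have dich₂ {a b : H →L[ℂ] H} (ha : IsDichotomic a) (hb : IsDichotomic b) (i : Fin 2) :
      IsDichotomic (![a, b] i) := by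
    fin_cases i <;> assumption
  have one : |(1 : ℝ)| = 1 := abs_one
  have neg : |(-1 : ℝ)| = 1 := by simp
  have d₁ := dich₄ (hA 0) (hA 1) (hB 2) hM₀
  have d₂ := dich₄ (hA 2) (hA 0) (hB 1) hM₁
  have d₃ := dich₄ (hA 1) (hA 2) (hB 0) hM₂
  have d₄ := dich₃ (hA 0) (hB 1) (hB 2)
  have d₅ := dich₃ (hB 0) (hA 1) (hB 2)
  have d₆ := dich₃ (hB 0) (hB 1) (hA 2)
  have d₇ := dich₃ (hA 0) (hA 1) (hA 2)
  have d₈ := dich₂ hM₂ hM₁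
  have d₉ := dich₂ hM₁ hM₀
  have d₁₀ := dich₂ hM₂ hM₀
  have b₁ := mul_permCorr_le_one (π₄ 0) d₁ hψ one
  have b₂ := mul_permCorr_le_one (π₄ 1) d₂ hψ one
  have b₃ := mul_permCorr_le_one (π₄ 2) d₃ hψ one
  have b₄ := mul_permCorr_le_one (π₃ 0) d₄ hψ one
  have b₅ := mul_permCorr_le_one (π₃ 1) d₅ hψ one
  have b₆ := mul_permCorr_le_one (π₃ 2) d₆ hψ one
  have b₇ := mul_permCorr_le_one (π₃ 3) d₇ hψ neg
  have b₈ := mul_permCorr_le_one (π₂ 0) d₈ hψ one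
  have b₉ := mul_permCorr_le_one (π₂ 1) d₉ hψ one
  have b₁₀ := mul_permCorr_le_one (π₂ 2) d₁₀ hψ one
  unfold T₃ at hmax
  -- Ten signed correlators bounded by 1 add up to 10, so each of them is exactly 1.
  have o₁ := allOrders_of_permCorr (π₄ 0) d₁ hψ one (by linarith)
  have o₂ := allOrders_of_permCorr (π₄ 1) d₂ hψ one (by linarith)
  have o₃ := allOrders_of_permCorr (π₄ 2) d₃ hψ one (by linarith)
  have o₄ := allOrders_of_permCorr (π₃ 0) d₄ hψ one (by linarith)
  have o₅ := allOrders_of_permCorr (π₃ 1) d₅ hψ one (by linarith)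
  have o₆ := allOrders_of_permCorr (π₃ 2) d₆ hψ one (by linarith)
  have o₇ := allOrders_of_permCorr (π₃ 3) d₇ hψ neg (by linarith)
  have o₉ := (allOrders_of_permCorr (π₂ 1) d₉ hψ one (by linarith)).apply_two
  have o₁₀ := (allOrders_of_permCorr (π₂ 2) d₁₀ hψ one (by linarith)).apply_two
  -- Pairing `M 2 0` and `M 1 2` with `M 0 1` shows that all three have the same image of `ψ`.
  rw [hM₁.apply_eq_iff, Complex.ofReal_one, one_smul] at o₉
  rw [hM₂.apply_eq_iff, Complex.ofReal_one, one_smul] at o₁₀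
  refine GraphRelations.of_allOrders hψ hA hB hM (fun i j hij => ?_) (fun i j hij => ?_)
    (fun i j hij => ?_) fun i j hij => ?_
  · refine forall_distinct (p := fun i j k => AllOrders ![A i, A j, B k, M i j] 1 ψ) o₁ o₃ o₂
      (fun i j k h => ?_) hij
    rw [hMsymm j i]
    exact h.swap_four
  · exact forall_distinct (p := fun i j k => AllOrders ![B i, B j, A k] 1 ψ) o₆ o₄.rotate_three
      o₅.swap_three.rotate_three.swap_three (fun i j k h => h.swap_three) hij
  · exact forall_distinct (p := fun i j k => AllOrders ![A i, A j, A k] (-1) ψ) o₇ o₇.rotate_three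
      o₇.rotate_three.rotate_three (fun i j k h => h.swap_three) hij
  · refine forall_distinct (p := fun i j _ => M i j ψ = M 0 1 ψ) rfl o₁₀.symm o₉.symm
      (fun i j _ h => ?_) hij
    rw [hMsymm j i, h]

end AllOrders

/-! ### The unitary matching the two orthonormal bases -/

section Unitary

variable {H : Type*} [NormedAddCommGroup H] [InnerProductSpace ℂ H]
  {A B : Fin 3 → (H →L[ℂ] H)} {M : Fin 3 → Fin 3 → (H →L[ℂ] H)} {ψ : H}

theorem graphVec_mem_V₃ (a : Fin 8) : graphVec A B ψ a ∈ V₃ A B ψ :=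
  Submodule.subset_span ⟨a, rfl⟩

theorem apply_mem_V₃ {T : H →L[ℂ] H} {act : Fin 8 → ℤ × Fin 8}
    (hT : ∀ a, T (graphVec A B ψ a) = ((act a).1 : ℂ) • graphVec A B ψ (act a).2) :
    ∀ v ∈ V₃ A B ψ, T v ∈ V₃ A B ψ := by
  intro v hv
  induction hv using Submodule.span_induction with
  | mem x hx =>
    obtain ⟨a, rfl⟩ := hx
    exact (hT a).symm ▸ Submodule.smul_mem _ _ (graphVec_mem_V₃ _)
  | zero => simp
  | add x y _ _ hx hy => simpa using Submodule.add_mem _ hx hy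
  | smul c x _ hx => simpa using Submodule.smul_mem _ c hx

variable [CompleteSpace H]

namespace GraphRelations

/-- The vectors `graphVec` form an orthonormal basis of `V₃`. -/
noncomputable def basis (h : GraphRelations A B M ψ) : OrthonormalBasis (Fin 8) ℂ (V₃ A B ψ) :=
  OrthonormalBasis.mk (v := fun a => (⟨graphVec A B ψ a, graphVec_mem_V₃ a⟩ : V₃ A B ψ))
    ((V₃ A B ψ).subtypeₗᵢ.orthonormal_comp_iff.1 h.orthonormal_graphVec) <| by
      -- Spanning inside the subspace is checked after the injective inclusion into `H`, where it is
      -- the definition of `V₃`.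
      refine top_le_iff.2 (Submodule.map_injective_of_injective (V₃ A B ψ).subtype_injective ?_)
      rw [Submodule.map_span, ← Set.range_comp, Submodule.map_top, Submodule.range_subtype]
      rfl

theorem basis_apply (h : GraphRelations A B M ψ) (a : Fin 8) :
    h.basis a = ⟨graphVec A B ψ a, graphVec_mem_V₃ a⟩ := by
  simp [basis]

end GraphRelations

/-- The orthonormal basis of three qubits obtained from the complete-graph state. -/
noncomputable def qubitBasis : OrthonormalBasis (Fin 8) ℂ ThreeQubits :=
  OrthonormalBasis.mk graphRelations_G₃.orthonormal_graphVec <| top_le_iff.2 <|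
    graphRelations_G₃.orthonormal_graphVec.linearIndependent.span_eq_top_of_card_eq_finrank' <| by
      simp

theorem qubitBasis_apply (a : Fin 8) : qubitBasis a = graphVec X Z G₃ a := by
  simp [qubitBasis]

/-- Operators that act by the same signed permutation are intertwined by the change of basis. -/
theorem equiv_compress_apply (h : GraphRelations A B M ψ) {T : H →L[ℂ] H}
    {T' : ThreeQubits →L[ℂ] ThreeQubits} {act : Fin 8 → ℤ × Fin 8}
    (hT : ∀ a, T (graphVec A B ψ a) = ((act a).1 : ℂ) • graphVec A B ψ (act a).2)
    (hT' : ∀ a, T' (graphVec X Z G₃ a) = ((act a).1 : ℂ) • graphVec X Z G₃ (act a).2)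
    (φ : ThreeQubits) :
    h.basis.equiv qubitBasis (Equiv.refl _)
      (compress (V₃ A B ψ) T ((h.basis.equiv qubitBasis (Equiv.refl _)).symm φ)) = T' φ := by
  set U := h.basis.equiv qubitBasis (Equiv.refl _) with hU
  have hUb (a : Fin 8) : U (h.basis a) = qubitBasis a := by simp [hU]
  have key : U.toLinearEquiv.toLinearMap ∘ₗ (compress (V₃ A B ψ) T).toLinearMap ∘ₗ
      U.symm.toLinearEquiv.toLinearMap = T'.toLinearMap := by
    refine qubitBasis.toBasis.ext fun a => ?_
    -- The image under `T` already lies in `V₃`, so the projection leaves it unchanged.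
    have h₁ : compress (V₃ A B ψ) T (h.basis a) = ((act a).1 : ℂ) • h.basis (act a).2 := by
      have h₂ : T (h.basis a : H) = (((act a).1 : ℂ) • h.basis (act a).2 : V₃ A B ψ) := by
        simp only [h.basis_apply, hT, Submodule.coe_smul]
      rw [compress, ContinuousLinearMap.comp_apply, ContinuousLinearMap.comp_apply,
        Submodule.subtypeL_apply, h₂, Submodule.orthogonalProjectionOnto_mem_subspace_eq_self]
    have h₃ : U.symm (qubitBasis a) = h.basis a := by rw [← hUb, U.symm_apply_apply]
    have h₄ : U (compress (V₃ A B ψ) T (U.symm (qubitBasis a))) = T' (qubitBasis a) := by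
      rw [h₃, h₁, map_smul, hUb, qubitBasis_apply, qubitBasis_apply, hT']
    simpa using h₄
  exact LinearMap.congr_fun key φ

end Unitary

end TemporalSelfTest

open TemporalSelfTest in
theorem theorem1 {H : Type*} [NormedAddCommGroup H] [InnerProductSpace ℂ H] [CompleteSpace H]
    (π₄ : Fin 3 → OrderSet 4) (π₃ : Fin 4 → OrderSet 3) (π₂ : Fin 3 → OrderSet 2)
    (ψ : H) (hψ : ‖ψ‖ = 1)
    (A B : Fin 3 → (H →L[ℂ] H)) (M : Fin 3 → Fin 3 → (H →L[ℂ] H))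
    (hA : ∀ i, IsDichotomic (A i)) (hB : ∀ i, IsDichotomic (B i))
    (hM : ∀ i j, i ≠ j → IsDichotomic (M i j)) (hMsymm : ∀ i j, M i j = M j i)
    (hmax : T₃ π₄ π₃ π₂ A B M ψ = 10) :
    Module.finrank ℂ (V₃ A B ψ) = 8 ∧
    (∀ i, ∀ v ∈ V₃ A B ψ, A i v ∈ V₃ A B ψ) ∧
    (∀ i, ∀ v ∈ V₃ A B ψ, B i v ∈ V₃ A B ψ) ∧
    (∀ i j, i ≠ j → ∀ v ∈ V₃ A B ψ, M i j v ∈ V₃ A B ψ) ∧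
    ∃ U : V₃ A B ψ ≃ₗᵢ[ℂ] ThreeQubits,
      (∀ i φ, U (compress (V₃ A B ψ) (A i) (U.symm φ)) = X i φ) ∧
      (∀ i φ, U (compress (V₃ A B ψ) (B i) (U.symm φ)) = Z i φ) ∧
      (∀ i j, i ≠ j → ∀ φ, U (compress (V₃ A B ψ) (M i j) (U.symm φ)) = XXZ i j φ) ∧
      U ((V₃ A B ψ).orthogonalProjectionOnto ψ) = G₃ := by
  have h := graphRelations_of_T₃_eq π₄ π₃ π₂ hψ hA hB hM hMsymm hmax
  have hG := graphRelations_G₃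
  refine ⟨?_, fun i => apply_mem_V₃ (h.A_graphVec i), fun i => apply_mem_V₃ (h.B_graphVec i),
    fun i j hij => apply_mem_V₃ (h.M_graphVec hij), h.basis.equiv qubitBasis (Equiv.refl _),
    fun i => equiv_compress_apply h (h.A_graphVec i) (hG.A_graphVec i),
    fun i => equiv_compress_apply h (h.B_graphVec i) (hG.B_graphVec i),
    fun i j hij => equiv_compress_apply h (h.M_graphVec hij) (hG.M_graphVec hij), ?_⟩
  · rw [Module.finrank_eq_card_basis h.basis.toBasis, Fintype.card_fin]
  · have h₁ : (V₃ A B ψ).orthogonalProjectionOnto ψ = h.basis 0 := by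
      rw [h.basis_apply]
      exact Submodule.orthogonalProjectionOnto_mem_subspace_eq_self
        (⟨ψ, graphVec_mem_V₃ (A := A) (B := B) 0⟩ : V₃ A B ψ)
    rw [h₁, OrthonormalBasis.equiv_apply_basis, Equiv.refl_apply, qubitBasis_apply]
    rfl
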